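/- Let $\theta,\beta>0$. For each integer $N\ge 1$ with $N\ge\theta$, consider the correlated random walk on $\mathbb{Z}$ with final time $N$, which starts at the origin and makes steps of size one to the left or to the right. Its steps are governed by the transition matrix $$V^K_N=\begin{bmatrix}1-(\theta/N)^{\beta} & (\theta/N)^{\beta}\\ (\theta/N)^{\beta} & 1-(\theta/N)^{\beta}\end{bmatrix},$$ that is, each of the $N$ steps is in the direction opposite to the previous direction with probability $(\theta/N)^{\beta}$ and in the same direction with probability $1-(\theta/N)^{\beta}$, given the past; the initial direction (the "previous direction" of the first step) is left or right with probability $1/2$ each. Let $p_N(0)$ be the probability that this walk is at the origin at its final time $N$. Let $$I_k(x)=\sum_{m\ge 0}\frac{(x/2)^{2m+k}}{m!\,(m+k)!}$$ be the modified Bessel function of the first kind of order $k$. (i) If $0<\beta<1$, then $\displaystyle\lim_{n\to\infty} n^{(\beta+1)/2}\,p_{2n}(0)=\frac{1}{\sqrt{\pi}}\left(\frac{\theta}{2}\right)^{\beta/2}$. (ii) If $\beta=1$, then $\displaystyle\lim_{n\to\infty} n\,p_{2n}(0)=\frac{\theta e^{-\theta}}{2}\,\{I_0(\theta)+I_1(\theta)\}$.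 (iii) If $\beta>1$, then $\displaystyle\lim_{n\to\infty} n^{\beta}\,p_{2n}(0)=\left(\frac{\theta}{2}\right)^{\beta}$. -/

import Mathlib

namespace CorrelatedWalk

/-- The modified Bessel function of the first kind of integer order `k`,
`I_k(x) = ∑_{m ≥ 0} (x / 2) ^ (2 m + k) / (m! (m + k)!)`. -/
noncomputable def besselI (k : ℕ) (x : ℝ) : ℝ :=
  ∑' m : ℕ, (x / 2) ^ (2 * m + k) / ((m.factorial : ℝ) * ((m + k).factorial : ℝ))

/-- The transition matrix `V^K_N` of the walk with final time `N`. Index `0` stands for "left" and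
index `1` for "right"; the entry `(i, j)` is the probability that the next step is in the direction
`i` when the previous step was in the direction `j`. -/
noncomputable def VK (θ β : ℝ) (N : ℕ) : Matrix (Fin 2) (Fin 2) ℝ :=
  !![1 - (θ / N) ^ β, (θ / N) ^ β;
     (θ / N) ^ β, 1 - (θ / N) ^ β]

/-- The initial distribution of the direction: left and right with probability `1 / 2` each. -/
noncomputable def initialDist : Fin 2 → ℝ := ![1 / 2, 1 / 2]

/-- The displacement of a single step: `-1` to the left and `+1` to the right. -/
def displacement : Fin 2 → ℤ := ![-1, 1]

/-- The probability of the sequence of directions `s 0, s 1, …, s k` under the Markov chain with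
transition matrix `V` and initial distribution `φ`. Here `s 0` is the initial direction (no move is
made in it) and `s 1, …, s k` are the directions of the first `k` steps. -/
def pathProb (V : Matrix (Fin 2) (Fin 2) ℝ) (φ : Fin 2 → ℝ) {k : ℕ} (s : Fin (k + 1) → Fin 2) : ℝ :=
  φ (s 0) * ∏ i : Fin k, V (s i.succ) (s i.castSucc)

/-- The position after `k` steps of the walker started at the origin. -/
def position {k : ℕ} (s : Fin (k + 1) → Fin 2) : ℤ :=
  ∑ i : Fin k, displacement (s i.succ)

/-- The probability that the correlated random walk with transition matrix `V` and initial
distribution `φ` is at `x` at time `k`. -/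
def positionProb (V : Matrix (Fin 2) (Fin 2) ℝ) (φ : Fin 2 → ℝ) (k : ℕ) (x : ℤ) : ℝ :=
  ∑ s : Fin (k + 1) → Fin 2 with position s = x, pathProb V φ s

/-- The return probability `p_N(0)`: the probability that the walk with final time `N`, all of whose
steps use the matrix `V^K_N`, is at the origin at time `N`. -/
noncomputable def returnProb (θ β : ℝ) (N : ℕ) : ℝ :=
  positionProb (VK θ β N) initialDist N 0

end CorrelatedWalk

/-! For a constant switching probability `p` the return probability has an exact Fourier formula, `p
/ (2π) * ∫ (1 + cos t) (1 - 2p(1 - p)(1 - cos t)) ^ m` over `[-π, π]` at time `2(m + 1)`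
(`positionProb_switchMatrix_eq_integral`). It holds because Fourier coefficients of a product of two
binomial generating functions obey the same first-step recursion as the walk
(`transProb_eq_integral`).

With `n = m + 1` and `p = (θ/2)^β n^(-β)`, everything depends on `2mp(1 - p)`, which is of order
`n^(1 - β)`. If it tends to `c` (`c = θ` for `β = 1`, `c = 0` for `β > 1`), the integrand tends to
`(1 + cos t) exp(-c(1 - cos t))`, whose integral is a sum of Bessel functions. If it diverges (`β <
1`), the integral concentrates at `t = 0` on the scale `1/K`, `K = √(mp(1 - p))`, and Laplace's
method gives `2√π / K`. -/

open MeasureTheory Filter Topology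

namespace CorrelatedWalk

/-! ### First-step analysis of the walk. -/

/-- The symmetric transition matrix with switching probability `p`. -/
def switchMatrix (p : ℝ) : Matrix (Fin 2) (Fin 2) ℝ := !![1 - p, p; p, 1 - p]

/-- The probability that the displacement in `k` steps is `x` given the previous direction `i`. -/
def transProb (V : Matrix (Fin 2) (Fin 2) ℝ) (k : ℕ) (i : Fin 2) (x : ℤ) : ℝ :=
  positionProb V (Pi.single i 1) k x

theorem position_cons {k : ℕ} (j : Fin 2) (s : Fin (k + 1) → Fin 2) :
    position (Fin.cons j s : Fin (k + 2) → Fin 2) = displacement (s 0) + position s := by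
  simp [position, Fin.sum_univ_succ]

theorem pathProb_cons (V : Matrix (Fin 2) (Fin 2) ℝ) (φ : Fin 2 → ℝ) {k : ℕ} (j : Fin 2)
    (s : Fin (k + 1) → Fin 2) :
    pathProb V φ (Fin.cons j s : Fin (k + 2) → Fin 2) =
      φ j * V (s 0) j * ∏ i : Fin k, V (s i.succ) (s i.castSucc) := by
  simp [pathProb, Fin.prod_univ_succ, mul_assoc]

theorem transProb_zero (V : Matrix (Fin 2) (Fin 2) ℝ) (i : Fin 2) (x : ℤ) :
    transProb V 0 i x = if x = 0 then 1 else 0 := by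
  unfold transProb positionProb
  rw [Finset.sum_filter, ← (Equiv.funUnique (Fin 1) (Fin 2)).symm.sum_comp]
  have hf : ∀ j, (Equiv.funUnique (Fin 1) (Fin 2)).symm j 0 = j := fun _ => rfl
  by_cases hx : x = 0
  · subst hx
    simp only [position, pathProb, hf]
    simp
  · have : ¬ (0 = x) := fun h => hx h.symm
    simp [position, hx, this]

theorem transProb_succ (V : Matrix (Fin 2) (Fin 2) ℝ) (k : ℕ) (i : Fin 2) (x : ℤ) :
    transProb V (k + 1) i x =
      V 0 i * transProb V k 0 (x + 1) + V 1 i * transProb V k 1 (x - 1) := by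
  have key : ∀ j : Fin 2, ∀ y : ℤ, transProb V k j y = ∑ s : Fin (k + 1) → Fin 2,
      if s 0 = j ∧ position s = y then ∏ i : Fin k, V (s i.succ) (s i.castSucc) else 0 := by
    intro j y
    unfold transProb positionProb
    rw [Finset.sum_filter]
    refine Finset.sum_congr rfl fun s _ => ?_
    by_cases h1 : s 0 = j <;> by_cases h2 : position s = y <;>
      simp [h1, h2, pathProb]
  rw [key, key, Finset.mul_sum, Finset.mul_sum, ← Finset.sum_add_distrib]
  unfold transProb positionProb
  rw [Finset.sum_filter, ← (Fin.consEquiv (fun _ : Fin (k + 2) => Fin 2)).sum_comp,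
    Fintype.sum_prod_type, Finset.sum_comm]
  refine Finset.sum_congr rfl fun s _ => ?_
  have hc : ∀ j : Fin 2, Fin.consEquiv (fun _ : Fin (k + 2) => Fin 2) (j, s) =
      (Fin.cons j s : Fin (k + 2) → Fin 2) := fun _ => rfl
  simp only [hc, position_cons, pathProb_cons, Pi.single_apply]
  have e1 : displacement 0 = -1 := rfl
  have e2 : displacement 1 = 1 := rfl
  have f1 : (-1 + position s = x) ↔ (position s = x + 1) := by omega
  have f2 : (1 + position s = x) ↔ (position s = x - 1) := by omega
  rcases Fin.exists_fin_two.1 ⟨s 0, rfl⟩ with h | h <;> fin_cases i <;>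
    simp [h, e1, e2, f1, f2]

theorem positionProb_initialDist (V : Matrix (Fin 2) (Fin 2) ℝ) (k : ℕ) (x : ℤ) :
    positionProb V initialDist k x = (transProb V k 0 x + transProb V k 1 x) / 2 := by
  unfold transProb positionProb
  rw [← Finset.sum_add_distrib, Finset.sum_div]
  refine Finset.sum_congr rfl fun s _ => ?_
  unfold pathProb
  rcases Fin.exists_fin_two.1 ⟨s 0, rfl⟩ with h | h <;> rw [h] <;> simp [initialDist] <;> ring

theorem transProb_eq_zero (V : Matrix (Fin 2) (Fin 2) ℝ) (k : ℕ) :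
    ∀ (i : Fin 2) (x : ℤ), (k : ℤ) < |x| → transProb V k i x = 0 := by
  induction k with
  | zero =>
    intro i x hx
    rw [transProb_zero, if_neg]
    rintro rfl
    simp at hx
  | succ k ih =>
    intro i x hx
    push_cast at hx
    rw [transProb_succ, ih, ih, mul_zero, mul_zero, add_zero] <;>
    · rw [lt_abs] at hx ⊢
      omega

/-- Only the path that never turns gets this far. -/
theorem transProb_right_end (p : ℝ) (k : ℕ) :
    transProb (switchMatrix p) k 1 k = (1 - p) ^ k := by
  induction k with
  | zero => simp [transProb_zero]
  | succ k ih =>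
    rw [transProb_succ, transProb_eq_zero _ k 0 _ (by rw [lt_abs]; push_cast; omega)]
    push_cast
    rw [add_sub_cancel_right, ih]
    simp [switchMatrix, pow_succ, mul_comm]

theorem transProb_left_end (p : ℝ) (k : ℕ) :
    transProb (switchMatrix p) k 0 (-k) = (1 - p) ^ k := by
  induction k with
  | zero => simp [transProb_zero]
  | succ k ih =>
    rw [transProb_succ, transProb_eq_zero _ k 1 _ (by rw [lt_abs]; push_cast; omega)]
    push_cast
    rw [neg_add_rev, neg_add_cancel_comm, ih]
    simp [switchMatrix, pow_succ, mul_comm]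

/-! ### Fourier representation. -/

/-- The point of the unit circle with angle `t`. -/
noncomputable def unitPt (t : ℝ) : ℂ := Complex.exp (t * Complex.I)

@[fun_prop]
theorem continuous_unitPt : Continuous unitPt := by unfold unitPt; fun_prop

theorem unitPt_ne_zero (t : ℝ) : unitPt t ≠ 0 := Complex.exp_ne_zero _

theorem unitPt_neg (t : ℝ) : unitPt (-t) = (unitPt t)⁻¹ := by
  simp [unitPt, ← Complex.exp_neg]

theorem integral_unitPt_pow {k : ℕ} (hk : k ≠ 0) :
    ∫ t in (-Real.pi)..Real.pi, unitPt t ^ k = 0 := by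
  have hc : (k : ℂ) * Complex.I ≠ 0 := by simp [hk]
  have h : ∀ t : ℝ, unitPt t ^ k = Complex.exp ((k * Complex.I) * t) := fun t => by
    rw [unitPt, ← Complex.exp_nat_mul]; ring_nf
  simp_rw [h]
  rw [integral_exp_mul_complex hc, div_eq_zero_iff]
  left
  rw [sub_eq_zero, Complex.exp_eq_exp_iff_exists_int]
  refine ⟨k, ?_⟩
  push_cast
  ring

/-- All frequencies are nonnegative, so only the constant term can survive; the induction peels off
one factor. -/
theorem integral_unitPt_pow_mul (p q : ℂ) (a k : ℕ) :
    ∫ t in (-Real.pi)..Real.pi, unitPt t ^ k * (q + p * unitPt t) ^ a =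
      if k = 0 then 2 * Real.pi * q ^ a else 0 := by
  induction a generalizing k with
  | zero =>
    split_ifs with hk
    · subst hk; simp; ring
    · simpa using integral_unitPt_pow hk
  | succ a ih =>
    have h : ∀ t, unitPt t ^ k * (q + p * unitPt t) ^ (a + 1) =
        q * (unitPt t ^ k * (q + p * unitPt t) ^ a) +
          p * (unitPt t ^ (k + 1) * (q + p * unitPt t) ^ a) := fun t => by ring
    simp_rw [h]
    rw [intervalIntegral.integral_add (Continuous.intervalIntegrable (by fun_prop) _ _)
      (Continuous.intervalIntegrable (by fun_prop) _ _), intervalIntegral.integral_const_mul,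
      intervalIntegral.integral_const_mul, ih, ih]
    split_ifs <;> simp_all
    ring

theorem integral_one_add_unitPt_mul (p q : ℂ) (a : ℕ) :
    ∫ t in (-Real.pi)..Real.pi, (1 + unitPt t) * (q + p * unitPt t) ^ a = 2 * Real.pi * q ^ a := by
  have h : ∀ t, (1 + unitPt t) * (q + p * unitPt t) ^ a =
      unitPt t ^ 0 * (q + p * unitPt t) ^ a + unitPt t ^ 1 * (q + p * unitPt t) ^ a :=
    fun t => by ring
  simp_rw [h]
  rw [intervalIntegral.integral_add (Continuous.intervalIntegrable (by fun_prop) _ _)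
    (Continuous.intervalIntegrable (by fun_prop) _ _), integral_unitPt_pow_mul,
    integral_unitPt_pow_mul]
  simp

theorem integral_one_add_unitPt_neg_mul (p q : ℂ) (a : ℕ) :
    ∫ t in (-Real.pi)..Real.pi, (1 + unitPt (-t)) * (q + p * unitPt (-t)) ^ a =
      2 * Real.pi * q ^ a := by
  rw [intervalIntegral.integral_comp_neg (fun t => (1 + unitPt t) * (q + p * unitPt t) ^ a),
    neg_neg, integral_one_add_unitPt_mul]

/-- The generating function of two binomial distributions with success probability `p`, one of
them reflected. -/
noncomputable def binomGen (p : ℝ) (a b : ℕ) (t : ℝ) : ℂ :=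
  (1 - p + p * unitPt t) ^ a * (1 - p + p * unitPt (-t)) ^ b

@[fun_prop]
theorem continuous_binomGen (p : ℝ) (a b : ℕ) : Continuous (binomGen p a b) := by
  unfold binomGen; fun_prop

/-- Both sides satisfy the same recursion in `a` and `b`, because `unitPt t * unitPt (-t) = 1`. The
displacements covered are those reachable with at least one turn; the straight path is left out. If
the first step turns and the rest is straight, the integral reduces to its constant term. -/
theorem transProb_eq_integral (p : ℝ) (k : ℕ) : ∀ a b : ℕ, a + b = k →
    2 * Real.pi * (transProb (switchMatrix p) (k + 1) 1 (a - b - 1) : ℂ) =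
        p * ∫ t in (-Real.pi)..Real.pi, (1 + unitPt (-t)) * binomGen p a b t ∧
    2 * Real.pi * (transProb (switchMatrix p) (k + 1) 0 (a - b + 1) : ℂ) =
        p * ∫ t in (-Real.pi)..Real.pi, (1 + unitPt t) * binomGen p a b t := by
  have hint : ∀ {f : ℝ → ℂ}, Continuous f →
      IntervalIntegrable f volume (-Real.pi) Real.pi := fun hf => hf.intervalIntegrable _ _
  have hz : ∀ t, unitPt t * unitPt (-t) = 1 := fun t => by
    rw [unitPt_neg, mul_inv_cancel₀ (unitPt_ne_zero t)]
  induction k with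
  | zero =>
    intro a b hab
    obtain ⟨rfl, rfl⟩ : a = 0 ∧ b = 0 := by omega
    have h1 := integral_one_add_unitPt_mul p (1 - p) 0
    have h2 := integral_one_add_unitPt_neg_mul p (1 - p) 0
    simp only [pow_zero, mul_one] at h1 h2
    simp only [binomGen, pow_zero, mul_one, h1, h2]
    simp [transProb_succ, transProb_zero, switchMatrix, mul_comm]
  | succ k ih =>
    intro a b hab
    constructor
    · rcases a with _ | a
      -- Extreme displacement: turn left at once, then never turn again.
      · obtain rfl : b = k + 1 := by omega
        rw [transProb_succ, transProb_eq_zero _ (k + 1) 1 _ (by rw [lt_abs]; push_cast; omega)]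
        have := transProb_left_end p (k + 1)
        have e : ((0 : ℕ) : ℤ) - ((k + 1 : ℕ) : ℤ) - 1 + 1 = -((k + 1 : ℕ) : ℤ) := by
          push_cast; ring
        simp only [binomGen, pow_zero, one_mul]
        rw [e, this, integral_one_add_unitPt_neg_mul]
        simp [switchMatrix]
        ring
      · obtain ⟨h1, h2⟩ := ih a b (by omega)
        rw [transProb_succ]
        have e1 : ((a + 1 : ℕ) : ℤ) - b - 1 + 1 = a - b + 1 := by push_cast; ring
        have e2 : ((a + 1 : ℕ) : ℤ) - b - 1 - 1 = a - b - 1 := by push_cast; ring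
        have h : ∀ t, (1 + unitPt (-t)) * binomGen p (a + 1) b t =
            (1 - p) * ((1 + unitPt (-t)) * binomGen p a b t) +
              p * ((1 + unitPt t) * binomGen p a b t) := fun t => by
          have := hz t
          simp only [binomGen, pow_succ]
          linear_combination (p : ℂ) * (1 - p + p * unitPt t) ^ a *
            (1 - p + p * unitPt (-t)) ^ b * this
        simp_rw [h]
        rw [e1, e2, intervalIntegral.integral_add (hint (by fun_prop)) (hint (by fun_prop)),
          intervalIntegral.integral_const_mul, intervalIntegral.integral_const_mul]
        simp only [switchMatrix, Matrix.of_apply, Matrix.cons_val', Matrix.cons_val_zero,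
          Matrix.cons_val_one, Matrix.cons_val_fin_one] at h1 h2 ⊢
        push_cast
        linear_combination (1 - p : ℂ) * h1 + p * h2
    · rcases b with _ | b
      · obtain rfl : a = k + 1 := by omega
        rw [transProb_succ, transProb_eq_zero _ (k + 1) 0 _ (by rw [lt_abs]; push_cast; omega)]
        have := transProb_right_end p (k + 1)
        have e : ((k + 1 : ℕ) : ℤ) - ((0 : ℕ) : ℤ) + 1 - 1 = ((k + 1 : ℕ) : ℤ) := by
          push_cast; ring
        simp only [binomGen, pow_zero, mul_one]
        rw [e, this, integral_one_add_unitPt_mul]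
        simp [switchMatrix]
        ring
      · obtain ⟨h1, h2⟩ := ih a b (by omega)
        rw [transProb_succ]
        have e1 : (a : ℤ) - (b + 1 : ℕ) + 1 + 1 = a - b + 1 := by push_cast; ring
        have e2 : (a : ℤ) - (b + 1 : ℕ) + 1 - 1 = a - b - 1 := by push_cast; ring
        have h : ∀ t, (1 + unitPt t) * binomGen p a (b + 1) t =
            p * ((1 + unitPt (-t)) * binomGen p a b t) +
              (1 - p) * ((1 + unitPt t) * binomGen p a b t) := fun t => by
          have := hz t
          simp only [binomGen, pow_succ]
          linear_combination (p : ℂ) * (1 - p + p * unitPt t) ^ a *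
            (1 - p + p * unitPt (-t)) ^ b * this
        simp_rw [h]
        rw [e1, e2, intervalIntegral.integral_add (hint (by fun_prop)) (hint (by fun_prop)),
          intervalIntegral.integral_const_mul, intervalIntegral.integral_const_mul]
        simp only [switchMatrix, Matrix.of_apply, Matrix.cons_val', Matrix.cons_val_zero,
          Matrix.cons_val_one, Matrix.cons_val_fin_one] at h1 h2 ⊢
        push_cast
        linear_combination (p : ℂ) * h1 + (1 - p) * h2

/-- The Fourier representation of the return probability. -/
theorem positionProb_switchMatrix_eq_integral (p : ℝ) (m : ℕ) :
    positionProb (switchMatrix p) initialDist (2 * (m + 1)) 0 =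
      p / (2 * Real.pi) * ∫ t in (-Real.pi)..Real.pi,
        (1 + Real.cos t) * (1 - 2 * p * (1 - p) * (1 - Real.cos t)) ^ m := by
  have hint : ∀ {f : ℝ → ℂ}, Continuous f →
      IntervalIntegrable f volume (-Real.pi) Real.pi := fun hf => hf.intervalIntegrable _ _
  obtain ⟨h1, h2⟩ := transProb_eq_integral p (m + m) m m rfl
  -- The uniform initial direction is stationary, so the first step is left or right with
  -- probability `1 / 2`, and the remaining `2m + 1` steps must undo it.
  have e : positionProb (switchMatrix p) initialDist (2 * (m + 1)) 0 =
      (transProb (switchMatrix p) (m + m + 1) 1 (m - m - 1) +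
        transProb (switchMatrix p) (m + m + 1) 0 (m - m + 1)) / 2 := by
    have : 2 * (m + 1) = m + m + 1 + 1 := by ring
    rw [positionProb_initialDist, this,
      transProb_succ _ (m + m + 1) 0 0, transProb_succ _ (m + m + 1) 1 0]
    simp only [sub_self, zero_add, zero_sub, switchMatrix, Matrix.of_apply, Matrix.cons_val',
      Matrix.cons_val_zero, Matrix.cons_val_one, Matrix.cons_val_fin_one]
    ring
  have hsum : ∀ t : ℝ, (1 + unitPt (-t)) * binomGen p m m t + (1 + unitPt t) * binomGen p m m t =
      ((2 * ((1 + Real.cos t) * (1 - 2 * p * (1 - p) * (1 - Real.cos t)) ^ m) : ℝ) : ℂ) := by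
    intro t
    have hz : unitPt t * unitPt (-t) = 1 := by
      rw [unitPt_neg, mul_inv_cancel₀ (unitPt_ne_zero t)]
    have hc : unitPt t + unitPt (-t) = 2 * Complex.cos t := by
      rw [Complex.two_cos, unitPt, unitPt]; simp
    -- Each pair of conjugate factors multiplies to `(1 - p)^2 + p^2 + 2p(1 - p) cos t`.
    have hb : binomGen p m m t = (1 - 2 * p * (1 - p) * (1 - Complex.cos t)) ^ m := by
      rw [binomGen, ← mul_pow]
      congr 1
      linear_combination (p : ℂ) ^ 2 * hz + (1 - p) * p * hc
    rw [hb]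
    push_cast
    linear_combination (1 - 2 * p * (1 - p) * (1 - Complex.cos t)) ^ m * hc
  have h3 : 2 * Real.pi * ((positionProb (switchMatrix p) initialDist (2 * (m + 1)) 0 : ℝ) : ℂ) =
      p * ((∫ t in (-Real.pi)..Real.pi,
        (1 + Real.cos t) * (1 - 2 * p * (1 - p) * (1 - Real.cos t)) ^ m : ℝ) : ℂ) := by
    have h4 := intervalIntegral.integral_add (μ := volume) (a := -Real.pi) (b := Real.pi)
      (f := fun t => (1 + unitPt (-t)) * binomGen p m m t)
      (g := fun t => (1 + unitPt t) * binomGen p m m t) (hint (by fun_prop)) (hint (by fun_prop))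
    simp_rw [hsum] at h4
    rw [intervalIntegral.integral_ofReal, intervalIntegral.integral_const_mul] at h4
    rw [e]
    push_cast at h1 h2 h4 ⊢
    linear_combination h1 / 2 + h2 / 2 - p / 2 * h4
  have hpi := Real.pi_ne_zero
  have h5 : 2 * Real.pi * positionProb (switchMatrix p) initialDist (2 * (m + 1)) 0 =
      p * ∫ t in (-Real.pi)..Real.pi,
        (1 + Real.cos t) * (1 - 2 * p * (1 - p) * (1 - Real.cos t)) ^ m := by
    exact_mod_cast h3
  rw [div_mul_eq_mul_div, eq_div_iff (by positivity)]
  linear_combination h5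

/-! ### Bessel functions as integrals. -/

theorem integral_cos_pow_even (m : ℕ) :
    ∫ t in (-Real.pi)..Real.pi, Real.cos t ^ (2 * m) =
      2 * Real.pi * ((2 * m).factorial / (4 ^ m * (m.factorial : ℝ) ^ 2)) := by
  induction m with
  | zero => simp; ring
  | succ m ih =>
    rw [show 2 * (m + 1) = 2 * m + 2 by ring, integral_cos_pow, ih, Nat.factorial_succ,
      Nat.factorial_succ, Nat.factorial_succ m]
    simp only [Real.sin_neg, Real.sin_pi]
    push_cast
    field_simp
    ring

theorem integral_cos_pow_odd (m : ℕ) :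
    ∫ t in (-Real.pi)..Real.pi, Real.cos t ^ (2 * m + 1) = 0 := by
  induction m with
  | zero => simp
  | succ m ih =>
    rw [show 2 * (m + 1) + 1 = 2 * m + 1 + 2 by ring, integral_cos_pow, ih]
    simp

/-- The exponential series is integrated termwise, dominated by the series of `exp |x|`. Odd moments
of the cosine vanish and the even ones yield the Bessel series. -/
theorem hasSum_integral_cos_pow_mul_exp (k : ℕ) (x : ℝ) :
    HasSum (fun j : ℕ => x ^ j / j.factorial * ∫ t in (-Real.pi)..Real.pi, Real.cos t ^ (j + k))
      (∫ t in (-Real.pi)..Real.pi, Real.cos t ^ k * Real.exp (x * Real.cos t)) := by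
  have hexp : ∀ y : ℝ, HasSum (fun j : ℕ => y ^ j / j.factorial) (Real.exp y) := fun y => by
    rw [Real.exp_eq_exp_ℝ]
    exact NormedSpace.expSeries_div_hasSum_exp y
  simp_rw [← intervalIntegral.integral_const_mul]
  refine intervalIntegral.hasSum_integral_of_dominated_convergence
    (fun j _ => |x| ^ j / j.factorial) (fun j => ?_) (fun j => ?_) ?_ ?_ ?_
  · exact Continuous.aestronglyMeasurable (by fun_prop)
  · refine ae_of_all _ fun t _ => ?_
    rw [Real.norm_eq_abs, abs_mul, abs_div, abs_pow, abs_pow, Nat.abs_cast]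
    exact mul_le_of_le_one_right (by positivity)
      (pow_le_one₀ (abs_nonneg _) (Real.abs_cos_le_one t))
  · exact ae_of_all _ fun t _ => (hexp |x|).summable
  · exact intervalIntegrable_const
  · refine ae_of_all _ fun t _ => ?_
    have h : (fun j : ℕ => x ^ j / j.factorial * Real.cos t ^ (j + k)) =
        fun j : ℕ => Real.cos t ^ k * ((x * Real.cos t) ^ j / j.factorial) := by
      funext j
      rw [mul_pow, pow_add]
      ring
    rw [h]
    exact (hexp (x * Real.cos t)).mul_left (Real.cos t ^ k)

theorem integral_exp_mul_cos (x : ℝ) :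
    ∫ t in (-Real.pi)..Real.pi, Real.exp (x * Real.cos t) = 2 * Real.pi * besselI 0 x := by
  have h := hasSum_integral_cos_pow_mul_exp 0 x
  have hinj : Function.Injective fun m : ℕ => 2 * m := fun a b hab => by
    simp only at hab; omega
  rw [← hinj.hasSum_iff] at h
  · simp only [pow_zero, one_mul] at h
    rw [← h.tsum_eq, besselI, ← tsum_mul_left]
    refine tsum_congr fun m => ?_
    simp only [Function.comp_apply, add_zero, integral_cos_pow_even, div_pow]
    rw [pow_mul 2 2 m]
    norm_num
    field_simp
  · intro j hj
    obtain ⟨m, rfl⟩ : Odd j := Nat.not_even_iff_odd.1 fun ⟨m, hm⟩ => hj ⟨m, by simp only; omega⟩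
    rw [add_zero, integral_cos_pow_odd, mul_zero]

theorem integral_cos_mul_exp_mul_cos (x : ℝ) :
    ∫ t in (-Real.pi)..Real.pi, Real.cos t * Real.exp (x * Real.cos t) =
      2 * Real.pi * besselI 1 x := by
  have h := hasSum_integral_cos_pow_mul_exp 1 x
  have hinj : Function.Injective fun m : ℕ => 2 * m + 1 := fun a b hab => by
    simp only at hab; omega
  rw [← hinj.hasSum_iff] at h
  · simp only [pow_one] at h
    rw [← h.tsum_eq, besselI, ← tsum_mul_left]
    refine tsum_congr fun m => ?_
    simp only [Function.comp_apply]
    rw [show 2 * m + 1 + 1 = 2 * (m + 1) by ring, integral_cos_pow_even, div_pow, pow_succ 2,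
      pow_mul 2 2 m, show 2 * (m + 1) = 2 * m + 1 + 1 by ring, Nat.factorial_succ (2 * m + 1),
      Nat.factorial_succ m]
    push_cast
    norm_num
    field_simp
    ring
  · intro j hj
    obtain ⟨m, rfl⟩ : Even j := Nat.not_odd_iff_even.1 fun ⟨m, hm⟩ => hj ⟨m, hm.symm⟩
    rw [← two_mul, integral_cos_pow_odd, mul_zero]

theorem integral_one_add_cos_mul_exp (x : ℝ) :
    ∫ t in (-Real.pi)..Real.pi, (1 + Real.cos t) * Real.exp (-x * (1 - Real.cos t)) =
      2 * Real.pi * Real.exp (-x) * (besselI 0 x + besselI 1 x) := by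
  have h : ∀ t, (1 + Real.cos t) * Real.exp (-x * (1 - Real.cos t)) =
      Real.exp (-x) * (Real.exp (x * Real.cos t) + Real.cos t * Real.exp (x * Real.cos t)) := by
    intro t
    rw [show -x * (1 - Real.cos t) = -x + x * Real.cos t by ring, Real.exp_add]
    ring
  simp_rw [h]
  rw [intervalIntegral.integral_const_mul, intervalIntegral.integral_add
    (Continuous.intervalIntegrable (by fun_prop) _ _)
    (Continuous.intervalIntegrable (by fun_prop) _ _),
    integral_exp_mul_cos, integral_cos_mul_exp_mul_cos]
  ring

/-! ### Asymptotics of the Fourier integral. -/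

/-- The integrand of the Fourier representation of the return probability. -/
noncomputable def returnKernel (p : ℝ) (m : ℕ) (t : ℝ) : ℝ :=
  (1 + Real.cos t) * (1 - 2 * p * (1 - p) * (1 - Real.cos t)) ^ m

@[fun_prop]
theorem continuous_returnKernel (p : ℝ) (m : ℕ) : Continuous (returnKernel p m) := by
  unfold returnKernel; fun_prop

/-- The expression is `|1 - p + p e^{it}|^2`. -/
theorem symbol_nonneg (p t : ℝ) :
    0 ≤ 1 - 2 * p * (1 - p) * (1 - Real.cos t) := by
  have h1 := Real.neg_one_le_cos t
  have h2 := Real.cos_le_one t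
  nlinarith [sq_nonneg (2 * p - 1), mul_nonneg (sq_nonneg (2 * p - 1)) (sub_nonneg.2 h2)]

theorem returnKernel_nonneg (p : ℝ) (m : ℕ) (t : ℝ) : 0 ≤ returnKernel p m t :=
  mul_nonneg (by linarith [Real.neg_one_le_cos t]) (pow_nonneg (symbol_nonneg p t) m)

theorem returnKernel_le (p : ℝ) (m : ℕ) (t : ℝ) :
    returnKernel p m t ≤ 2 * Real.exp (-(m * (2 * p * (1 - p) * (1 - Real.cos t)))) := by
  have h : (1 - 2 * p * (1 - p) * (1 - Real.cos t)) ^ m ≤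
      Real.exp (-(m * (2 * p * (1 - p) * (1 - Real.cos t)))) := by
    rw [← mul_neg, Real.exp_nat_mul]
    refine pow_le_pow_left₀ (symbol_nonneg p t) ?_ m
    linarith [Real.add_one_le_exp (-(2 * p * (1 - p) * (1 - Real.cos t)))]
  unfold returnKernel
  have h1 := Real.neg_one_le_cos t
  have h2 := Real.cos_le_one t
  exact mul_le_mul (by linarith) h (pow_nonneg (symbol_nonneg p t) m) (by norm_num)

theorem tendsto_integral_returnKernel {p : ℕ → ℝ} {c : ℝ}
    (hp : ∀ᶠ m in atTop, 0 < p m ∧ p m < 1)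
    (hc : Tendsto (fun m : ℕ => m * (2 * p m * (1 - p m))) atTop (𝓝 c)) :
    Tendsto (fun m => ∫ t in (-Real.pi)..Real.pi, returnKernel (p m) m t) atTop
      (𝓝 (∫ t in (-Real.pi)..Real.pi, (1 + Real.cos t) * Real.exp (-c * (1 - Real.cos t)))) := by
  refine intervalIntegral.tendsto_integral_filter_of_dominated_convergence (fun _ => 2) ?_ ?_ ?_ ?_
  · exact Eventually.of_forall fun m => Continuous.aestronglyMeasurable (by fun_prop)
  · filter_upwards [hp] with m ⟨h0, h1⟩
    refine ae_of_all _ fun t _ => ?_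
    rw [Real.norm_of_nonneg (returnKernel_nonneg _ _ _)]
    refine (returnKernel_le _ _ _).trans (mul_le_of_le_one_right (by norm_num) ?_)
    rw [Real.exp_le_one_iff, neg_nonpos]
    have := sub_nonneg.2 (Real.cos_le_one t)
    have := sub_pos.2 h1
    positivity
  · exact intervalIntegrable_const
  · refine ae_of_all _ fun t _ => ?_
    have h : Tendsto (fun m : ℕ => (m : ℝ) * -(2 * p m * (1 - p m) * (1 - Real.cos t))) atTop
        (𝓝 (-c * (1 - Real.cos t))) := by
      convert (hc.mul_const (1 - Real.cos t)).neg using 2 <;> ring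
    have h2 := (Real.tendsto_one_add_pow_exp_of_tendsto h).const_mul (1 + Real.cos t)
    simpa only [returnKernel, ← sub_eq_add_neg] using h2

/-- With `1 - cos u = 2 sin² (u/2)`, the left side is `s² sinc² (s / (2K))`. -/
theorem tendsto_two_mul_sq_mul_one_sub_cos_div {K : ℕ → ℝ} (hK : Tendsto K atTop atTop) (s : ℝ) :
    Tendsto (fun m => 2 * K m ^ 2 * (1 - Real.cos (s / K m))) atTop (𝓝 (s ^ 2)) := by
  have h0 : Tendsto (fun m => s / K m / 2) atTop (𝓝 0) := by
    simpa using (hK.const_div_atTop s).div_const 2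
  have h1 := ((Real.continuous_sinc.tendsto 0).comp h0).pow 2 |>.const_mul (s ^ 2)
  rw [Real.sinc_zero, one_pow, mul_one] at h1
  refine h1.congr' ?_
  filter_upwards [hK.eventually_gt_atTop 0] with m hm
  by_cases hs : s = 0
  · simp [hs]
  have e : Real.cos (s / K m) = 1 - 2 * Real.sin (s / K m / 2) ^ 2 := by
    rw [show s / K m = 2 * (s / K m / 2) by ring, Real.cos_two_mul, Real.cos_sq']
    ring_nf
  rw [Function.comp_apply, Real.sinc_of_ne_zero (by positivity), e]
  field_simp
  ring

/-- Laplace's method: after substituting `t = s / K`, the integrand tends to `2 exp(-s²)`, whose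
integral is `2√π`. -/
theorem tendsto_mul_integral_returnKernel {p : ℕ → ℝ}
    (hp : ∀ᶠ m in atTop, 0 < p m ∧ p m < 1)
    (hK : Tendsto (fun m : ℕ => √(m * (p m * (1 - p m)))) atTop atTop) :
    Tendsto (fun m : ℕ => √(m * (p m * (1 - p m))) *
      ∫ t in (-Real.pi)..Real.pi, returnKernel (p m) m t) atTop (𝓝 (2 * √Real.pi)) := by
  set K : ℕ → ℝ := fun m => √(m * (p m * (1 - p m))) with hKdef
  have hpi := Real.pi_pos
  have hKsq : ∀ᶠ m in atTop, K m ^ 2 = m * (p m * (1 - p m)) := by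
    filter_upwards [hp] with m ⟨h0, h1⟩
    have := sub_pos.2 h1
    exact Real.sq_sqrt (by positivity)
  -- Extension by zero puts all rescaled integrands on the whole line, where one Gaussian dominates
  -- them.
  let F : ℕ → ℝ → ℝ := fun m => (Set.Ioc (-(Real.pi * K m)) (Real.pi * K m)).indicator
    fun s => returnKernel (p m) m (s / K m)
  have hF : ∀ᶠ m in atTop, ∫ s, F m s =
      K m * ∫ t in (-Real.pi)..Real.pi, returnKernel (p m) m t := by
    filter_upwards [hK.eventually_gt_atTop 0] with m hm
    rw [integral_indicator measurableSet_Ioc, ← intervalIntegral.integral_of_le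
      (by nlinarith [mul_pos hpi hm]),
      intervalIntegral.integral_comp_div (fun s => returnKernel (p m) m s) hm.ne', smul_eq_mul,
      neg_div, mul_div_cancel_right₀ _ hm.ne']
  have hlim : ∫ s : ℝ, 2 * Real.exp (-1 * s ^ 2) = 2 * √Real.pi := by
    rw [integral_const_mul, integral_gaussian, div_one]
  rw [← hlim]
  refine Tendsto.congr' hF ?_
  refine tendsto_integral_filter_of_dominated_convergence
    (fun s => 2 * Real.exp (-(4 / Real.pi ^ 2) * s ^ 2)) ?_ ?_ ?_ ?_
  · refine Eventually.of_forall fun m => AEStronglyMeasurable.indicator ?_ measurableSet_Ioc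
    exact Continuous.aestronglyMeasurable (by fun_prop)
  · filter_upwards [hK.eventually_gt_atTop 0, hKsq, hp] with m hm hsq ⟨h0, h1⟩
    refine ae_of_all _ fun s => ?_
    simp only [F, Set.indicator_apply]
    split_ifs with hs
    · rw [Real.norm_of_nonneg (returnKernel_nonneg _ _ _)]
      refine (returnKernel_le _ _ _).trans ?_
      gcongr
      -- The quadratic bound on the cosine holds on all of `[-π, π]`; multiplied by `2K²` it gives
      -- the rate `4 / π²` of the majorant.
      have hcos : Real.cos (s / K m) ≤ 1 - 2 / Real.pi ^ 2 * (s / K m) ^ 2 := by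
        refine Real.cos_le_one_sub_mul_cos_sq ?_
        rw [abs_div, abs_of_pos hm, div_le_iff₀ hm]
        exact abs_le.2 ⟨hs.1.le, hs.2⟩
      have e1 : (m : ℝ) * (2 * p m * (1 - p m) * (1 - Real.cos (s / K m))) =
          2 * K m ^ 2 * (1 - Real.cos (s / K m)) := by rw [hsq]; ring
      have e2 : 4 / Real.pi ^ 2 * s ^ 2 = 2 * K m ^ 2 * (2 / Real.pi ^ 2 * (s / K m) ^ 2) := by
        field_simp
        ring
      rw [e1, neg_mul, e2]
      gcongr
      linarith
    · simp only [norm_zero]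
      positivity
  · exact (integrable_exp_neg_mul_sq (by positivity)).const_mul 2
  · refine ae_of_all _ fun s => ?_
    have hcosK : Tendsto (fun m => 1 + Real.cos (s / K m)) atTop (𝓝 2) := by
      have := ((Real.continuous_cos.tendsto 0).comp (hK.const_div_atTop s)).const_add 1
      rw [Real.cos_zero] at this
      norm_num at this
      exact this
    have hpow : Tendsto (fun m : ℕ => (m : ℝ) *
        -(2 * p m * (1 - p m) * (1 - Real.cos (s / K m)))) atTop (𝓝 (-1 * s ^ 2)) := by
      have := (tendsto_two_mul_sq_mul_one_sub_cos_div hK s).neg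
      rw [← neg_one_mul (s ^ 2)] at this
      refine this.congr' ?_
      filter_upwards [hKsq] with m hsq
      rw [hsq]
      ring
    refine (hcosK.mul (Real.tendsto_one_add_pow_exp_of_tendsto hpow)).congr' ?_
    -- For fixed `s` the growing window eventually contains `s`.
    filter_upwards [hK.eventually_gt_atTop (|s| / Real.pi), hK.eventually_gt_atTop 0] with m hm hm0
    have hs : |s| < Real.pi * K m := by
      rwa [div_lt_iff₀ hpi, mul_comm] at hm
    have hmem : s ∈ Set.Ioc (-(Real.pi * K m)) (Real.pi * K m) :=
      ⟨(abs_lt.1 hs).1, (abs_lt.1 hs).2.le⟩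
    simp only [F, Set.indicator_of_mem hmem, returnKernel, ← sub_eq_add_neg]

/-! ### The three regimes of `β`. -/

/-- The switching probability `(θ / N) ^ β` of the walk with final time `N = 2 (m + 1)`. -/
noncomputable def switchProb (θ β : ℝ) (m : ℕ) : ℝ := (θ / 2) ^ β * ((m : ℝ) + 1) ^ (-β)

theorem returnProb_eq_integral {θ : ℝ} (hθ : 0 < θ) (β : ℝ) (m : ℕ) :
    returnProb θ β (2 * (m + 1)) = switchProb θ β m / (2 * Real.pi) *
      ∫ t in (-Real.pi)..Real.pi, returnKernel (switchProb θ β m) m t := by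
  have h : VK θ β (2 * (m + 1)) = switchMatrix (switchProb θ β m) := by
    have e : (θ / ((2 * (m + 1) : ℕ) : ℝ)) ^ β = switchProb θ β m := by
      rw [switchProb, Real.rpow_neg (by positivity), ← div_eq_mul_inv,
        ← Real.div_rpow (by positivity) (by positivity)]
      push_cast
      rw [div_div]
    rw [VK, switchMatrix, e]
  rw [returnProb, h, positionProb_switchMatrix_eq_integral]
  rfl

theorem tendsto_natCast_add_one : Tendsto (fun m : ℕ => (m : ℝ) + 1) atTop atTop :=
  tendsto_natCast_atTop_atTop.atTop_add tendsto_const_nhds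

theorem switchProb_pos {θ : ℝ} (hθ : 0 < θ) (β : ℝ) (m : ℕ) : 0 < switchProb θ β m := by
  unfold switchProb; positivity

theorem tendsto_switchProb (θ : ℝ) {β : ℝ} (hβ : 0 < β) :
    Tendsto (switchProb θ β) atTop (𝓝 0) := by
  change Tendsto (fun m : ℕ => (θ / 2) ^ β * ((m : ℝ) + 1) ^ (-β)) atTop (𝓝 0)
  simpa using ((tendsto_rpow_neg_atTop hβ).comp tendsto_natCast_add_one).const_mul ((θ / 2) ^ β)

theorem eventually_switchProb_mem_Ioo {θ β : ℝ} (hθ : 0 < θ) (hβ : 0 < β) :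
    ∀ᶠ m in atTop, 0 < switchProb θ β m ∧ switchProb θ β m < 1 := by
  filter_upwards [(tendsto_switchProb θ hβ).eventually_lt_const one_pos] with m hm
  exact ⟨switchProb_pos hθ β m, hm⟩

/-- The factor by which the variance parameter differs from its leading order. -/
noncomputable def varianceRatio (θ β : ℝ) (m : ℕ) : ℝ :=
  (m : ℝ) / ((m : ℝ) + 1) * (1 - switchProb θ β m)

theorem tendsto_varianceRatio (θ : ℝ) {β : ℝ} (hβ : 0 < β) :
    Tendsto (varianceRatio θ β) atTop (𝓝 1) := by
  change Tendsto (fun m : ℕ => (m : ℝ) / ((m : ℝ) + 1) * (1 - switchProb θ β m)) atTop (𝓝 1)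
  simpa using (tendsto_natCast_div_add_atTop (1 : ℝ)).mul
    ((tendsto_switchProb θ hβ).const_sub 1)

theorem mul_switchProb_mul_one_sub (θ β : ℝ) (m : ℕ) :
    (m : ℝ) * (switchProb θ β m * (1 - switchProb θ β m)) =
      varianceRatio θ β m * ((θ / 2) ^ β * ((m : ℝ) + 1) ^ (1 - β)) := by
  have h : ((m : ℝ) + 1) ^ (1 - β) = ((m : ℝ) + 1) * ((m : ℝ) + 1) ^ (-β) := by
    rw [sub_eq_add_neg, Real.rpow_add (by positivity), Real.rpow_one]
  have hm : (m : ℝ) + 1 ≠ 0 := by positivity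
  rw [h, varianceRatio]
  nth_rewrite 1 [switchProb]
  field_simp

theorem tendsto_returnProb_of_lt_one {θ β : ℝ} (hθ : 0 < θ) (hβ : 0 < β) (hβ1 : β < 1) :
    Tendsto (fun n : ℕ => (n : ℝ) ^ ((β + 1) / 2) * returnProb θ β (2 * n)) atTop
      (𝓝 (1 / √Real.pi * (θ / 2) ^ (β / 2))) := by
  rw [← tendsto_add_atTop_iff_nat 1]
  have hr := tendsto_varianceRatio θ hβ
  have hK : Tendsto (fun m : ℕ => √(m * (switchProb θ β m * (1 - switchProb θ β m))))
      atTop atTop := by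
    refine Real.tendsto_sqrt_atTop.comp ?_
    simp_rw [mul_switchProb_mul_one_sub]
    exact hr.pos_mul_atTop one_pos (((tendsto_rpow_atTop (sub_pos.2 hβ1)).comp
      tendsto_natCast_add_one).const_mul_atTop (by positivity))
  have hint := tendsto_mul_integral_returnKernel (eventually_switchProb_mem_Ioo hθ hβ) hK
  -- With `r` the variance ratio, `n^((β+1)/2) p = (θ/2)^(β/2) K / √r`: the normalisation supplies
  -- exactly the factor `K` of Laplace's method.
  have hmain := ((hr.sqrt.inv₀ (by simp)).const_mul ((θ / 2) ^ (β / 2) / (2 * Real.pi))).mul hint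
  have elim : (θ / 2) ^ (β / 2) / (2 * Real.pi) * (√1)⁻¹ * (2 * √Real.pi) =
      1 / √Real.pi * (θ / 2) ^ (β / 2) := by
    have := Real.mul_self_sqrt Real.pi_pos.le
    have hpi := Real.pi_pos
    rw [Real.sqrt_one]
    field_simp
    linarith
  rw [elim] at hmain
  refine hmain.congr' ?_
  filter_upwards [hr.eventually_const_lt one_pos] with m hrm
  have hm : (0 : ℝ) < (m : ℝ) + 1 := by positivity
  have hsq : √(m * (switchProb θ β m * (1 - switchProb θ β m))) =
      √(varianceRatio θ β m) * ((θ / 2) ^ (β / 2) * ((m : ℝ) + 1) ^ ((1 - β) / 2)) := by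
    rw [mul_switchProb_mul_one_sub, Real.sqrt_mul hrm.le, Real.sqrt_mul (by positivity),
      Real.sqrt_eq_rpow ((θ / 2) ^ β), Real.sqrt_eq_rpow (((m : ℝ) + 1) ^ (1 - β)),
      ← Real.rpow_mul (by positivity), ← Real.rpow_mul hm.le]
    ring_nf
  have e1 : (θ / 2) ^ β = (θ / 2) ^ (β / 2) * (θ / 2) ^ (β / 2) := by
    rw [← Real.rpow_add (by positivity), add_halves]
  have e2 : ((m : ℝ) + 1) ^ ((β + 1) / 2) * ((m : ℝ) + 1) ^ (-β) =
      ((m : ℝ) + 1) ^ ((1 - β) / 2) := by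
    rw [← Real.rpow_add hm]
    ring_nf
  have e3 : ((m : ℝ) + 1) ^ ((β + 1) / 2) * switchProb θ β m =
      (θ / 2) ^ (β / 2) * ((θ / 2) ^ (β / 2) * ((m : ℝ) + 1) ^ ((1 - β) / 2)) := by
    rw [switchProb, e1, ← e2]
    ring
  have hs : √(varianceRatio θ β m) ≠ 0 := (Real.sqrt_pos.2 hrm).ne'
  rw [returnProb_eq_integral hθ, hsq, Nat.cast_add_one]
  linear_combination ((θ / 2) ^ (β / 2) * ((θ / 2) ^ (β / 2) * ((m : ℝ) + 1) ^ ((1 - β) / 2)) *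
    (∫ t in (-Real.pi)..Real.pi, returnKernel (switchProb θ β m) m t) / (2 * Real.pi)) *
    mul_inv_cancel₀ hs -
    (∫ t in (-Real.pi)..Real.pi, returnKernel (switchProb θ β m) m t) / (2 * Real.pi) * e3

/-- Since `n^β p = (θ/2)^β` exactly, only the limit of the integral is needed. This serves both `β =
1` and `β > 1`. -/
theorem tendsto_rpow_mul_returnProb {θ β c : ℝ} (hθ : 0 < θ) (hβ : 0 < β)
    (hc : Tendsto (fun m : ℕ => 2 * (θ / 2) ^ β * ((m : ℝ) + 1) ^ (1 - β)) atTop (𝓝 c)) :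
    Tendsto (fun n : ℕ => (n : ℝ) ^ β * returnProb θ β (2 * n)) atTop
      (𝓝 ((θ / 2) ^ β * Real.exp (-c) * (besselI 0 c + besselI 1 c))) := by
  rw [← tendsto_add_atTop_iff_nat 1]
  have hvar : Tendsto (fun m : ℕ => m * (2 * switchProb θ β m * (1 - switchProb θ β m)))
      atTop (𝓝 c) := by
    have := (tendsto_varianceRatio θ hβ).mul hc
    rw [one_mul] at this
    refine this.congr fun m => ?_
    linear_combination (-2) * mul_switchProb_mul_one_sub θ β m
  have hint := (tendsto_integral_returnKernel (eventually_switchProb_mem_Ioo hθ hβ) hvar).const_mul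
    ((θ / 2) ^ β / (2 * Real.pi))
  have hpi := Real.pi_pos
  rw [integral_one_add_cos_mul_exp] at hint
  have elim : (θ / 2) ^ β / (2 * Real.pi) *
      (2 * Real.pi * Real.exp (-c) * (besselI 0 c + besselI 1 c)) =
      (θ / 2) ^ β * Real.exp (-c) * (besselI 0 c + besselI 1 c) := by
    field_simp
  rw [elim] at hint
  refine hint.congr fun m => ?_
  have hm : (0 : ℝ) < (m : ℝ) + 1 := by positivity
  have e : ((m : ℝ) + 1) ^ β * switchProb θ β m = (θ / 2) ^ β := by
    rw [switchProb, mul_left_comm, ← Real.rpow_add hm, add_neg_cancel, Real.rpow_zero, mul_one]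
  rw [returnProb_eq_integral hθ, Nat.cast_add_one, ← e]
  ring

theorem besselI_zero_zero : besselI 0 0 = 1 := by
  rw [besselI, tsum_eq_single 0]
  · simp
  · intro m hm
    simp [hm]

theorem besselI_zero_right {k : ℕ} (hk : k ≠ 0) : besselI k 0 = 0 := by
  simp [besselI, hk]

end CorrelatedWalk

theorem corollary4 (θ β : ℝ) (hθ : 0 < θ) (hβ : 0 < β) :
    (β < 1 → Filter.Tendsto
      (fun n : ℕ => (n : ℝ) ^ ((β + 1) / 2) * CorrelatedWalk.returnProb θ β (2 * n))
      Filter.atTop (nhds (1 / Real.sqrt Real.pi * (θ / 2) ^ (β / 2)))) ∧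
    (β = 1 → Filter.Tendsto
      (fun n : ℕ => (n : ℝ) * CorrelatedWalk.returnProb θ β (2 * n))
      Filter.atTop (nhds (θ * Real.exp (-θ) / 2 *
        (CorrelatedWalk.besselI 0 θ + CorrelatedWalk.besselI 1 θ)))) ∧
    (1 < β → Filter.Tendsto
      (fun n : ℕ => (n : ℝ) ^ β * CorrelatedWalk.returnProb θ β (2 * n))
      Filter.atTop (nhds ((θ / 2) ^ β))) := by
  refine ⟨CorrelatedWalk.tendsto_returnProb_of_lt_one hθ hβ, ?_, fun h => ?_⟩
  · rintro rfl
    have h := CorrelatedWalk.tendsto_rpow_mul_returnProb (c := θ) hθ hβ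
      (by simp [mul_div_cancel₀])
    simp only [Real.rpow_one] at h
    convert h using 2
    ring
  -- For `β > 1` the limit parameter is `c = 0`, where the Bessel factor is `1`.
  · have hc : Tendsto (fun m : ℕ => 2 * (θ / 2) ^ β * ((m : ℝ) + 1) ^ (1 - β)) atTop (𝓝 0) := by
      have := ((tendsto_rpow_neg_atTop (sub_pos.2 h)).comp
        CorrelatedWalk.tendsto_natCast_add_one).const_mul (2 * (θ / 2) ^ β)
      simpa using this
    simpa [CorrelatedWalk.besselI_zero_zero, CorrelatedWalk.besselI_zero_right] using
      CorrelatedWalk.tendsto_rpow_mul_returnProb hθ hβ hc
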